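/- For every integer $k\ge 1$ there is a constant $c>0$, depending only on $k$, such that the following holds. Let $n=L_1\cdots L_k$ qubits sit at the sites of a $k$-dimensional lattice with side lengths $L_1,\dots,L_k\ge 1$ and periodic boundary conditions. Let $\mathcal A$ be a local nearest-neighbour architecture with $m\ge 1$ layers $S^{(1)},\dots,S^{(m)}$, where each layer is a set of pairwise disjoint pairs of distinct neighbouring sites, and let $\mathcal U^{(t)}(\sigma)=U^{(t)}\sigma U^{(t)\dagger}$, where $U^{(t)}$ is the tensor product of two-qubit unitaries acting on the pairs in $S^{(t)}$ and of the identity on the remaining qubits; all these two-qubit unitaries are independent and Haar distributed on $U(4)$. Let $\mathcal N$ be the layer of noise that applies to every qubit the depolarizing channel $\sigma\mapsto(1-p)\sigma+p\,\mathrm{tr}(\sigma)I/2$, with $p\in[0,1]$. The random channel of depth $D=2m$ is $$\Phi=T_D\circ\cdots\circ T_1,\qquad T_t=\mathcal N\circ\mathcal U^{(t)}\ (t\le D/2),\qquad T_t=\mathcal N\circ\big[\mathcal U^{(D+1-t)}\big]^{\dagger}\ (t>D/2),$$ and $\Phi_{\mathrm{avg}}(\rho)=\mathbb E[\Phi(\rho)]$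 is its average over the random unitaries. Let $G=(V,E)$ be an unweighted simple graph whose vertices are the $n$ qubits, in which every vertex has degree at most $\Delta$, where $\Delta\ge 1$ (the edges of $G$ need not respect the lattice), and let $C=\frac12\sum_{\{i,j\}\in E}(1-Z_iZ_j)$. Then for every density operator $\rho$ and every $\alpha>0$, $$\operatorname{Prob}\Big[\big|\mathrm{tr}(C\,\Phi(\rho))-\mathrm{tr}(C\,\Phi_{\mathrm{avg}}(\rho))\big|\ge\alpha|E|\Big]\le 2\exp\!\left(-c\,\frac{\alpha^2|E|}{\Delta^2D^{2k}}\right).$$ -/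

import Mathlib

open MeasureTheory
open scoped Matrix ComplexOrder

noncomputable section

namespace NoisyCircuit

/-! ### Haar-random two-qubit gates -/

/-- The group `U(4)` of two-qubit unitaries; the two qubits are the two factors of the index. -/
abbrev TwoQubitGate : Type := Matrix.unitaryGroup (Fin 2 × Fin 2) ℂ

instance : MeasurableSpace TwoQubitGate := borel _

instance : BorelSpace TwoQubitGate := ⟨rfl⟩

instance : CompactSpace TwoQubitGate := by
  refine isCompact_iff_compactSpace.mp ?_
  have hK : IsCompact (Set.pi Set.univ fun _ : Fin 2 × Fin 2 =>
      Set.pi Set.univ fun _ : Fin 2 × Fin 2 => Metric.closedBall (0 : ℂ) 1) :=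
    isCompact_univ_pi fun _ => isCompact_univ_pi fun _ => isCompact_closedBall _ _
  refine IsCompact.of_isClosed_subset hK ?_ ?_
  · have h : ((Matrix.unitaryGroup (Fin 2 × Fin 2) ℂ :
        Submonoid (Matrix (Fin 2 × Fin 2) (Fin 2 × Fin 2) ℂ)) :
        Set (Matrix (Fin 2 × Fin 2) (Fin 2 × Fin 2) ℂ)) = {A | A * star A = 1} := by
      ext A
      exact Matrix.mem_unitaryGroup_iff
    rw [h]
    exact isClosed_eq (by fun_prop) continuous_const
  · intro A hA i _ j _
    rw [mem_closedBall_zero_iff]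
    exact entry_norm_bound_of_unitary hA i j

/-- The normalized Haar measure on `U(4)`. -/
def gateHaar : Measure TwoQubitGate := Measure.haarMeasure ⊤

instance : IsProbabilityMeasure gateHaar :=
  ⟨by
    have h := Measure.haarMeasure_self (G := TwoQubitGate) (K₀ := ⊤)
    simpa [gateHaar] using h⟩

/-! ### Operators on a register of qubits

A register has one qubit for each element of a finite type `Q`. Its computational basis is
`Q → Fin 2`, and its operators are the complex matrices indexed by this basis. -/

section Register

variable (Q : Type) [Fintype Q] [DecidableEq Q]

/-- Operators on the register `Q`. -/
abbrev Op : Type := Matrix (Q → Fin 2) (Q → Fin 2) ℂ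

variable {Q}

/-- A density operator. -/
def IsState (ρ : Op Q) : Prop := ρ.PosSemidef ∧ ρ.trace = 1

/-- The tensor product of the two-qubit operators `U g`, with `U g` acting on the ordered pair of
qubits `g ∈ P`, and of the identity on the qubits that belong to no pair of `P`. It is meant for
pairwise disjoint pairs of distinct qubits. -/
def layerUnitary (P : Finset (Q × Q)) (U : P → TwoQubitGate) : Op Q := fun x y =>
  (∏ g : P, (U g).1 (x g.1.1, x g.1.2) (y g.1.1, y g.1.2)) *
    ∏ c : Q with ∀ g ∈ P, c ≠ g.1 ∧ c ≠ g.2, if x c = y c then 1 else 0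

/-- The one-qubit depolarizing channel `σ ↦ (1 - p) σ + p tr(σ) I / 2`. -/
def depolarize (p : ℝ) (σ : Matrix (Fin 2) (Fin 2) ℂ) : Matrix (Fin 2) (Fin 2) ℂ :=
  ((1 - p : ℝ) : ℂ) • σ + ((p : ℂ) * σ.trace / 2) • (1 : Matrix (Fin 2) (Fin 2) ℂ)

/-- The noise layer `𝒩^{⊗ Q}`: the tensor power of the depolarizing channel, that is, the linear
map that sends the matrix unit `⨂ s, |x' s⟩⟨y' s|` to `⨂ s, depolarize p |x' s⟩⟨y' s|`. -/
def noiseLayer (p : ℝ) (ρ : Op Q) : Op Q := fun x y =>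
  ∑ x' : Q → Fin 2, ∑ y' : Q → Fin 2,
    (∏ s : Q, depolarize p (Matrix.single (x' s) (y' s) 1) (x s) (y s)) * ρ x' y'

/-- The eigenvalue of the Pauli operator `Z` on a computational basis state. -/
def zSign (b : Fin 2) : ℝ := if b = 0 then 1 else -1

/-- The unweighted cut value `∑_{ {i, j} ∈ E} (1 - z_i z_j) / 2`. -/
def cutValue (G : SimpleGraph Q) [DecidableRel G.Adj] (x : Q → Fin 2) : ℝ :=
  ∑ e ∈ G.edgeFinset,
    Sym2.lift ⟨fun i j => (1 - zSign (x i) * zSign (x j)) / 2,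
      fun i j => by simp only [mul_comm]⟩ e

/-- The Max-Cut cost operator, diagonal in the computational basis. -/
def cutOp (G : SimpleGraph Q) [DecidableRel G.Adj] : Op Q :=
  Matrix.diagonal fun x => (cutValue G x : ℂ)

end Register

/-! ### Local architectures in `k` dimensions -/

/-- The sites of the `k`-dimensional lattice with side lengths `L i` and periodic boundary
conditions. There is one qubit at each site. -/
abbrev Site (k : ℕ) (L : Fin k → ℕ) : Type := (i : Fin k) → ZMod (L i)

/-- Distinct sites that differ by one unit in exactly one coordinate direction. -/
def NearestNeighbor {k : ℕ} {L : Fin k → ℕ} (a b : Site k L) : Prop :=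
  a ≠ b ∧ ∃ i : Fin k, b = a + Pi.single i 1 ∨ a = b + Pi.single i 1

/-- A local architecture of nearest-neighbour gates with `m` entangling layers: each layer consists
of pairwise disjoint pairs of neighbouring sites, on which the two-qubit gates act. -/
structure LocalArchitecture (k : ℕ) (L : Fin k → ℕ) (m : ℕ) where
  /-- The pairs of qubits on which a gate acts in a layer. -/
  pairs : Fin m → Finset (Site k L × Site k L)
  neighbor : ∀ t, ∀ g ∈ pairs t, NearestNeighbor g.1 g.2
  disjoint : ∀ t, ∀ g ∈ pairs t, ∀ h ∈ pairs t, g ≠ h →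
    g.1 ≠ h.1 ∧ g.1 ≠ h.2 ∧ g.2 ≠ h.1 ∧ g.2 ≠ h.2

namespace LocalArchitecture

variable {k : ℕ} {L : Fin k → ℕ} {m : ℕ} [∀ i, NeZero (L i)]

/-- The depth of the circuit: `m` entangling layers followed by the `m` uncomputing layers. -/
def depth (_A : LocalArchitecture k L m) : ℕ := 2 * m

/-- A circuit instance: one two-qubit unitary for each gate of the `m` entangling layers. -/
abbrev Instance (A : LocalArchitecture k L m) : Type :=
  ((t : Fin m) × A.pairs t) → TwoQubitGate

/-- The law of the random circuit: the gates are independent and Haar distributed. -/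
def law (A : LocalArchitecture k L m) : Measure A.Instance :=
  Measure.pi fun _ => gateHaar

/-- The unitary of layer `t`. -/
def unitary (A : LocalArchitecture k L m) (ω : A.Instance) (t : Fin m) : Op (Site k L) :=
  layerUnitary (A.pairs t) fun g => ω ⟨t, g⟩

/-- The noisy circuit `Φ` of depth `2 m`: the layers `U⁽¹⁾, …, U⁽ᵐ⁾` are applied in this order, and
then their inverses in the opposite order; every layer is followed by a layer of noise. -/
def channel (A : LocalArchitecture k L m) (p : ℝ) (ω : A.Instance) (ρ : Op (Site k L)) :
    Op (Site k L) :=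
  (List.finRange m).reverse.foldl
    (fun σ t => noiseLayer p ((A.unitary ω t)ᴴ * σ * A.unitary ω t))
    ((List.finRange m).foldl
      (fun σ t => noiseLayer p (A.unitary ω t * σ * (A.unitary ω t)ᴴ)) ρ)

/-- The averaged channel `Φ_avg(ρ) = ∫ Φ(ρ) dU`, with the integral taken entry by entry. -/
def avgChannel (A : LocalArchitecture k L m) (p : ℝ) (ρ : Op (Site k L)) : Op (Site k L) :=
  fun x y => ∫ ω, A.channel p ω ρ x y ∂A.law

/-- The cut value `tr(C Φ(ρ))` of a circuit instance. -/
def cutOutput (A : LocalArchitecture k L m) (G : SimpleGraph (Site k L)) [DecidableRel G.Adj]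
    (p : ℝ) (ρ : Op (Site k L)) (ω : A.Instance) : ℝ :=
  (cutOp G * A.channel p ω ρ).trace.re

/-- The cut value `tr(C Φ_avg(ρ))` of the averaged channel. -/
def avgCutOutput (A : LocalArchitecture k L m) (G : SimpleGraph (Site k L)) [DecidableRel G.Adj]
    (p : ℝ) (ρ : Op (Site k L)) : ℝ :=
  (cutOp G * A.avgChannel p ρ).trace.re

end LocalArchitecture

end NoisyCircuit

end

/-!
Write the cut operator as a sum over edges. In the Heisenberg picture the observable of the edge
`{i, j}` starts out supported on `i` and `j`. Noise does not enlarge its support, and in each layer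
of gates the gates that do not touch the support cancel against their adjoints
(`exists_supportedOn_conj_layerOp`). After `D` layers the support lies in the union of the balls of
radius `D` around `i` and `j`, so the output of the edge is a function of the gates that act there
(`edgeOutput_dependsOn`). It takes values in `[0, 1]`, because the circuit maps states to states.

The light cones of two edges can have a common gate only if the edges have endpoints at distance at
most `2 D + 1`. Hence an edge is in conflict with fewer than `K = 2 (4 D + 3) ^ k Δ` other edges
(`ncard_conflict_lt`), and a greedy colouring splits the edges into `K` classes in which the light
cones are pairwise disjoint. The outputs of the edges of one class are independent, so by
Hoeffding's lemma their sum is sub-Gaussian with variance proxy at most `|E| / 4`. The standard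
deviation proxies of the `K` classes add up, which gives the variance proxy `K ^ 2 * |E| / 4` for
the whole cut value (`measure_abs_sum_sub_ge_le`), and the Chernoff bound gives the claim. Counting
conflicts between edges, rather than the influence of each single gate as in the bounded differences
inequality, is what avoids a further factor `D` in the exponent: gates that share a light cone need
not be counted one by one.
-/

noncomputable section

namespace NoisyCircuit

/-! ### Concentration for sums of local functions of independent variables -/

section Concentration

open ProbabilityTheory

/-- Greedy colouring: if every element of `s` is in conflict with fewer than `K` others, then `K`
colours suffice to separate all conflicting elements. -/
theorem exists_coloring_of_card_conflict_lt {E : Type*} [DecidableEq E] (r : E → E → Prop)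
    [DecidableRel r] (hr : ∀ a b, r a b → r b a) {K : ℕ} (s : Finset E)
    (hs : ∀ a ∈ s, (s.filter fun b => b ≠ a ∧ r a b).card < K) :
    ∃ col : E → ℕ, (∀ a ∈ s, col a < K) ∧
      ∀ a ∈ s, ∀ b ∈ s, a ≠ b → r a b → col a ≠ col b := by
  induction s using Finset.induction_on with
  | empty => exact ⟨fun _ => 0, by simp, by simp⟩
  | insert a s ha ih =>
    obtain ⟨col, hcol, hsep⟩ := ih fun b hb => lt_of_le_of_lt
      (Finset.card_le_card (Finset.filter_subset_filter _ (Finset.subset_insert a s)))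
      (hs b (Finset.mem_insert_of_mem hb))
    have hcard : ((((insert a s).filter fun b => b ≠ a ∧ r a b).image col)).card <
        (Finset.range K).card := by
      rw [Finset.card_range]
      exact lt_of_le_of_lt Finset.card_image_le (hs a (Finset.mem_insert_self a s))
    obtain ⟨j, hjK, hj⟩ := Finset.exists_mem_notMem_of_card_lt_card hcard
    have hfree : ∀ b ∈ s, r a b → j ≠ col b := by
      rintro b hb hab rfl
      refine hj (Finset.mem_image_of_mem col ?_)
      simp only [Finset.mem_filter, Finset.mem_insert]
      exact ⟨Or.inr hb, fun h => ha (h ▸ hb), hab⟩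
    have hne : ∀ b ∈ s, b ≠ a := fun b hb h => ha (h ▸ hb)
    refine ⟨Function.update col a j, ?_, ?_⟩
    · intro b hb
      rcases Finset.mem_insert.mp hb with rfl | hb
      · simpa using hjK
      · simpa [hne b hb] using hcol b hb
    · intro b hb c hc hbc hrbc
      rcases Finset.mem_insert.mp hb with rfl | hb'
      · rcases Finset.mem_insert.mp hc with rfl | hc'
        · exact absurd rfl hbc
        · simpa [hne c hc'] using hfree c hc' hrbc
      · rcases Finset.mem_insert.mp hc with rfl | hc'
        · simpa [hne b hb'] using (hfree b hb' (hr _ _ hrbc)).symm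
        · simpa [hne b hb', hne c hc'] using hsep b hb' c hc' hbc hrbc

theorem dependsOn_finset_sum {ι Ω E : Type*} [DecidableEq ι] (X : E → (ι → Ω) → ℝ)
    (S : E → Finset ι) (hdep : ∀ a, DependsOn (X a) (S a : Set ι)) (s : Finset E) :
    DependsOn (fun ω => ∑ a ∈ s, X a ω) (s.biUnion S : Finset ι) := by
  intro ω ω' h
  refine Finset.sum_congr rfl fun a ha => hdep a fun i hi => h i ?_
  exact Finset.mem_coe.mpr (Finset.mem_biUnion.mpr ⟨a, ha, hi⟩)

variable {ι Ω : Type*} [Fintype ι] [MeasurableSpace Ω]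

/-- Measurable functions that depend on disjoint sets of independent coordinates are independent. -/
theorem indepFun_of_dependsOn (μ : Measure Ω) [IsProbabilityMeasure μ] {f g : (ι → Ω) → ℝ}
    (hf : Measurable f) (hg : Measurable g) {S T : Finset ι} (hST : Disjoint S T)
    (hfS : DependsOn f S) (hgT : DependsOn g T) :
    IndepFun f g (Measure.pi fun _ : ι => μ) := by
  classical
  obtain ⟨x₀⟩ : Nonempty Ω := nonempty_of_isProbabilityMeasure μ
  -- The function that completes a partial assignment on `A` by the constant value `x₀`.
  have key : ∀ (h : (ι → Ω) → ℝ) (A : Finset ι), Measurable h → DependsOn h (A : Set ι) →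
      ∃ φ : (A → Ω) → ℝ, Measurable φ ∧ h = fun ω => φ fun i => ω i := by
    intro h A hm hA
    refine ⟨fun u => h fun i => if hi : i ∈ A then u ⟨i, hi⟩ else x₀, ?_, ?_⟩
    · refine hm.comp (measurable_pi_lambda _ fun i => ?_)
      by_cases hi : i ∈ A
      · simpa [hi] using measurable_pi_apply (⟨i, hi⟩ : A)
      · simp [hi]
    · funext ω
      refine hA fun i hi => ?_
      rw [dif_pos (Finset.mem_coe.mp hi)]
  obtain ⟨φ, hφ, rfl⟩ := key f S hf hfS
  obtain ⟨ψ, hψ, rfl⟩ := key g T hg hgT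
  have hi : iIndepFun (fun (i : ι) (ω : ι → Ω) => ω i) (Measure.pi fun _ : ι => μ) :=
    iIndepFun_pi (X := fun _ x => x) fun _ => aemeasurable_id
  exact (hi.indepFun_finset S T hST fun i => measurable_pi_apply i).comp hφ hψ

/-- A sum of `[0, 1]`-valued functions of pairwise disjoint sets of coordinates is sub-Gaussian. -/
theorem hasSubgaussianMGF_sum_of_pairwise_disjoint {E : Type*} (μ : Measure Ω)
    [IsProbabilityMeasure μ] (X : E → (ι → Ω) → ℝ) (S : E → Finset ι)
    (hm : ∀ a, Measurable (X a)) (hX : ∀ a ω, X a ω ∈ Set.Icc (0 : ℝ) 1)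
    (hdep : ∀ a, DependsOn (X a) (S a : Set ι)) (s : Finset E)
    (hs : ∀ a ∈ s, ∀ b ∈ s, a ≠ b → Disjoint (S a) (S b)) :
    HasSubgaussianMGF
      (fun ω => ∑ a ∈ s, (X a ω - ∫ ω, X a ω ∂(Measure.pi fun _ : ι => μ)))
      (s.card * (1 / 4)) (Measure.pi fun _ : ι => μ) := by
  classical
  induction s using Finset.induction_on with
  | empty => simp
  | insert a s ha ih =>
    have h1 : HasSubgaussianMGF
        (fun ω => X a ω - ∫ ω, X a ω ∂(Measure.pi fun _ : ι => μ)) (1 / 4)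
        (Measure.pi fun _ : ι => μ) := by
      have h := hasSubgaussianMGF_of_mem_Icc (hm a).aemeasurable
        (Filter.Eventually.of_forall (hX a)) (μ := Measure.pi fun _ : ι => μ)
      have hc : (‖(1 : ℝ) - 0‖₊ / 2) ^ 2 = (1 / 4 : NNReal) := by
        rw [sub_zero, nnnorm_one]
        norm_num
      rwa [hc] at h
    have h2 := ih fun b hb c hc =>
      hs b (Finset.mem_insert_of_mem hb) c (Finset.mem_insert_of_mem hc)
    have hind : IndepFun (fun ω => X a ω - ∫ ω, X a ω ∂(Measure.pi fun _ : ι => μ))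
        (fun ω => ∑ b ∈ s, (X b ω - ∫ ω, X b ω ∂(Measure.pi fun _ : ι => μ)))
        (Measure.pi fun _ : ι => μ) := by
      refine indepFun_of_dependsOn μ ((hm a).sub_const _)
        (Finset.measurable_sum _ fun b _ => (hm b).sub_const _) (S := S a) (T := s.biUnion S) ?_ ?_
        (dependsOn_finset_sum _ S (fun b ω ω' h => by simp only [hdep b h]) s)
      · rw [Finset.disjoint_biUnion_right]
        exact fun b hb => hs a (Finset.mem_insert_self a s) b (Finset.mem_insert_of_mem hb)
          fun h => ha (h ▸ hb)
      · intro ω ω' h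
        simp only [hdep a h]
    have h3 := h1.add_of_indepFun h2 hind
    simp_rw [Finset.sum_insert ha]
    rw [Finset.card_insert_of_notMem ha]
    have hc : (((s.card + 1 : ℕ) : NNReal) * (1 / 4)) = 1 / 4 + s.card * (1 / 4) := by
      push_cast
      ring
    rw [hc]
    exact h3

/-- Without any independence, the standard deviation proxies of sub-Gaussian variables add up. -/
theorem hasSubgaussianMGF_sum_range {Ω' : Type*} [MeasurableSpace Ω'] {μ : Measure Ω'}
    [IsProbabilityMeasure μ] (Y : ℕ → Ω' → ℝ) {c : NNReal} (K : ℕ)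
    (hY : ∀ j < K, HasSubgaussianMGF (Y j) c μ) :
    HasSubgaussianMGF (fun ω => ∑ j ∈ Finset.range K, Y j ω) ((K : NNReal) ^ 2 * c) μ := by
  induction K with
  | zero => simp
  | succ K ih =>
    have h := (ih fun j hj => hY j (hj.trans K.lt_succ_self)).add (hY K K.lt_succ_self)
    simp_rw [Finset.sum_range_succ]
    have hc : (NNReal.sqrt ((K : NNReal) ^ 2 * c) + NNReal.sqrt c) ^ 2 =
        ((K + 1 : ℕ) : NNReal) ^ 2 * c := by
      rw [NNReal.sqrt_mul, NNReal.sqrt_sq]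
      calc ((K : NNReal) * NNReal.sqrt c + NNReal.sqrt c) ^ 2
          = ((K : NNReal) + 1) ^ 2 * NNReal.sqrt c ^ 2 := by ring
        _ = _ := by rw [NNReal.sq_sqrt]; push_cast; rfl
    rwa [hc] at h

theorem HasSubgaussianMGF.mono_param {Ω' : Type*} [MeasurableSpace Ω'] {μ : Measure Ω'}
    {Y : Ω' → ℝ} {c d : NNReal} (h : HasSubgaussianMGF Y c μ) (hcd : c ≤ d) :
    HasSubgaussianMGF Y d μ where
  integrable_exp_mul := h.integrable_exp_mul
  mgf_le t := (h.mgf_le t).trans (Real.exp_le_exp.mpr (by gcongr))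

/-- A concentration inequality of Janson's type. If each of the `[0, 1]`-valued functions `X a` of
the independent coordinates shares coordinates with fewer than `K` others, then their sum deviates
from its mean as if it were `K` times a sum of `s.card` independent variables. -/
theorem measure_abs_sum_sub_ge_le {E : Type*} (μ : Measure Ω)
    [IsProbabilityMeasure μ] (X : E → (ι → Ω) → ℝ) (S : E → Finset ι)
    (hm : ∀ a, Measurable (X a)) (hX : ∀ a ω, X a ω ∈ Set.Icc (0 : ℝ) 1)
    (hdep : ∀ a, DependsOn (X a) (S a : Set ι)) (s : Finset E) (K : ℕ)
    (hs : ∀ a ∈ s, {b ∈ (s : Set E) | b ≠ a ∧ ¬ Disjoint (S a) (S b)}.ncard < K)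
    {ε : ℝ} (hε : 0 ≤ ε) :
    (Measure.pi fun _ : ι => μ).real
      {ω | ε ≤ |∑ a ∈ s, X a ω - ∑ a ∈ s, ∫ ω, X a ω ∂(Measure.pi fun _ : ι => μ)|} ≤
      2 * Real.exp (-(2 * ε ^ 2 / ((K : ℝ) ^ 2 * s.card))) := by
  classical
  set P : Measure (ι → Ω) := Measure.pi fun _ : ι => μ with hP
  obtain ⟨col, hcol, hsep⟩ := exists_coloring_of_card_conflict_lt
    (fun a b => ¬ Disjoint (S a) (S b)) (fun a b h h' => h h'.symm) (K := K) s (by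
      intro a ha
      have h := hs a ha
      rw [← Set.ncard_coe_finset]
      convert h using 2
      ext b
      simp)
  have hclass : ∀ j < K, HasSubgaussianMGF
      (fun ω => ∑ a ∈ s with col a = j, (X a ω - ∫ ω, X a ω ∂P)) (s.card * (1 / 4)) P := by
    intro j _
    refine HasSubgaussianMGF.mono_param
      (hasSubgaussianMGF_sum_of_pairwise_disjoint μ X S hm hX hdep _ ?_) ?_
    · intro a ha b hb hab
      rw [Finset.mem_filter] at ha hb
      by_contra h
      exact hsep a ha.1 b hb.1 hab h (ha.2.trans hb.2.symm)
    · gcongr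
      exact Finset.filter_subset _ _
  have hsum := hasSubgaussianMGF_sum_range
    (fun j ω => ∑ a ∈ s with col a = j, (X a ω - ∫ ω, X a ω ∂P)) K hclass
  have heq : (fun ω => ∑ j ∈ Finset.range K, ∑ a ∈ s with col a = j, (X a ω - ∫ ω, X a ω ∂P)) =
      fun ω => ∑ a ∈ s, X a ω - ∑ a ∈ s, ∫ ω, X a ω ∂P := by
    funext ω
    rw [Finset.sum_fiberwise_of_maps_to fun a ha => Finset.mem_range.mpr (hcol a ha),
      Finset.sum_sub_distrib]
  rw [heq] at hsum
  have hexp : -ε ^ 2 / (2 * (((K : NNReal) ^ 2 * (s.card * (1 / 4)) : NNReal) : ℝ)) =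
      -(2 * ε ^ 2 / ((K : ℝ) ^ 2 * s.card)) := by
    push_cast
    rw [show 2 * ((K : ℝ) ^ 2 * (s.card * (1 / 4))) = (K : ℝ) ^ 2 * s.card / 2 by ring,
      div_div_eq_mul_div, neg_mul, neg_div, mul_comm]
  have hup := hsum.measure_ge_le hε
  have hlow := hsum.neg.measure_ge_le hε
  rw [hexp] at hup hlow
  set Y : (ι → Ω) → ℝ := fun ω => ∑ a ∈ s, X a ω - ∑ a ∈ s, ∫ ω, X a ω ∂P with hY
  calc P.real {ω | ε ≤ |Y ω|} ≤ P.real ({ω | ε ≤ Y ω} ∪ {ω | ε ≤ (-Y) ω}) := by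
        refine measureReal_mono fun ω hω => ?_
        have h : ε ≤ |Y ω| := hω
        exact le_abs.mp h
    _ ≤ P.real {ω | ε ≤ Y ω} + P.real {ω | ε ≤ (-Y) ω} := measureReal_union_le _ _
    _ ≤ _ := by rw [two_mul]; exact add_le_add hup hlow

end Concentration

section Register

variable {Q : Type} [Fintype Q] [DecidableEq Q]

/-! ### Supports of operators -/

/-- The operator `O` acts as the identity outside of the set of qubits `X`, that is, `O` is the
tensor product of an operator on `X` and of the identity on `Xᶜ`. This is expressed by the matrix
entries: they vanish unless row and column agree outside of `X`, and they do not change when row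
and column are shifted by the same `d : Q → Fin 2` that vanishes on `X`. -/
structure SupportedOn (X : Set Q) (O : Op Q) : Prop where
  eq_zero : ∀ x y c, c ∉ X → x c ≠ y c → O x y = 0
  shift : ∀ d : Q → Fin 2, (∀ c ∈ X, d c = 0) → ∀ x y, O (x + d) (y + d) = O x y

namespace SupportedOn

omit [Fintype Q] [DecidableEq Q] in
theorem mono {X Y : Set Q} {O : Op Q} (h : SupportedOn X O) (hXY : X ⊆ Y) : SupportedOn Y O :=
  ⟨fun x y c hc => h.eq_zero x y c fun hc' => hc (hXY hc'),
    fun d hd => h.shift d fun c hc => hd c (hXY hc)⟩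

theorem mul {X : Set Q} {A B : Op Q} (hA : SupportedOn X A) (hB : SupportedOn X B) :
    SupportedOn X (A * B) := by
  refine ⟨fun x y c hc hxy => ?_, fun d hd x y => ?_⟩
  · rw [Matrix.mul_apply]
    refine Finset.sum_eq_zero fun z _ => ?_
    by_cases hz : x c = z c
    · rw [hB.eq_zero z y c hc (hz ▸ hxy), mul_zero]
    · rw [hA.eq_zero x z c hc hz, zero_mul]
  · rw [Matrix.mul_apply, Matrix.mul_apply]
    refine (Fintype.sum_equiv (Equiv.addRight d) _ _ fun z => ?_).symm
    rw [Equiv.coe_addRight, hA.shift d hd, hB.shift d hd]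

omit [Fintype Q] [DecidableEq Q] in
theorem conjTranspose {X : Set Q} {A : Op Q} (hA : SupportedOn X A) : SupportedOn X Aᴴ := by
  refine ⟨fun x y c hc hxy => ?_, fun d hd x y => ?_⟩
  · rw [Matrix.conjTranspose_apply, hA.eq_zero y x c hc hxy.symm, star_zero]
  · rw [Matrix.conjTranspose_apply, Matrix.conjTranspose_apply, hA.shift d hd]

/-- Operators with disjoint supports commute. -/
theorem commute {X Y : Set Q} {A B : Op Q} (hA : SupportedOn X A) (hB : SupportedOn Y B)
    (hXY : Disjoint X Y) : A * B = B * A := by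
  ext x y
  rw [Matrix.mul_apply, Matrix.mul_apply]
  -- A path `x → z → y` with a nonzero contribution to `A * B` changes `X` first and `Y` second;
  -- `x + y - z` is the intermediate point of the path in the opposite order.
  refine Fintype.sum_equiv (Equiv.subLeft (x + y)) _ _ fun z => ?_
  rw [Equiv.subLeft_apply]
  by_cases hz : (∀ c ∉ X, x c = z c) ∧ ∀ c ∉ Y, z c = y c
  · have h1 : A (x + y - z) y = A x z := by
      rw [← hA.shift (y - z) (fun c hc => ?_) x z]
      · congr 1 <;> abel
      · rw [Pi.sub_apply, hz.2 c (Set.disjoint_left.mp hXY hc), sub_self]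
    have h2 : B x (x + y - z) = B z y := by
      rw [← hB.shift (x - z) (fun c hc => ?_) z y]
      · congr 1 <;> abel
      · rw [Pi.sub_apply, hz.1 c (Set.disjoint_right.mp hXY hc), sub_self]
    rw [h1, h2, mul_comm]
  · rw [not_and_or] at hz
    push Not at hz
    rcases hz with ⟨c, hc, hne⟩ | ⟨c, hc, hne⟩
    · rw [hA.eq_zero x z c hc hne, hA.eq_zero (x + y - z) y c hc, zero_mul, mul_zero]
      intro h
      refine hne (sub_eq_zero.mp ?_)
      have h' : x c + y c - z c = y c := h
      calc x c - z c = x c + y c - z c - y c := by abel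
        _ = 0 := by rw [h', sub_self]
    · rw [hB.eq_zero z y c hc hne, hB.eq_zero x (x + y - z) c hc, zero_mul, mul_zero]
      intro h
      refine hne (sub_eq_zero.mp ?_)
      have h' : x c = x c + y c - z c := h
      calc z c - y c = x c - (x c + y c - z c) := by abel
        _ = 0 := by rw [← h', sub_self]

omit [DecidableEq Q] in
theorem diagonal {X : Set Q} (f : (Q → Fin 2) → ℂ)
    (hf : ∀ d : Q → Fin 2, (∀ c ∈ X, d c = 0) → ∀ x, f (x + d) = f x) :
    SupportedOn X (Matrix.diagonal f : Op Q) := by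
  refine ⟨fun x y c _ hxy => Matrix.diagonal_apply_ne _ fun h => hxy (h ▸ rfl),
    fun d hd x y => ?_⟩
  simp only [Matrix.diagonal_apply, add_left_inj, hf d hd]

end SupportedOn

/-! ### Layers of two-qubit gates -/

/-- The product of two-qubit operators `u g` on the pairs `g ∈ P`, with the identity elsewhere. It
extends `layerUnitary` to families `u` that are indexed by all pairs of qubits, which makes it
possible to split `P`. -/
def layerOp (P : Finset (Q × Q)) (u : Q × Q → Matrix (Fin 2 × Fin 2) (Fin 2 × Fin 2) ℂ) : Op Q :=
  fun x y => (∏ g ∈ P, u g (x g.1, x g.2) (y g.1, y g.2)) *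
    ∏ c : Q with ∀ g ∈ P, c ≠ g.1 ∧ c ≠ g.2, if x c = y c then 1 else 0

theorem layerUnitary_eq_layerOp (P : Finset (Q × Q)) (U : P → TwoQubitGate) :
    layerUnitary P U =
      layerOp P fun g => if h : g ∈ P then (U ⟨g, h⟩).1 else 1 := by
  funext x y
  unfold layerUnitary layerOp
  congr 1
  rw [← Finset.prod_coe_sort P fun g : Q × Q =>
    (if h : g ∈ P then (U ⟨g, h⟩).1 else 1) (x g.1, x g.2) (y g.1, y g.2)]
  refine Finset.prod_congr rfl fun g _ => ?_
  rw [dif_pos g.2]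

/-- The pairs in `P` are pairwise disjoint and consist of two distinct qubits each. -/
structure IsLayer (P : Finset (Q × Q)) : Prop where
  ne : ∀ g ∈ P, g.1 ≠ g.2
  disjoint : ∀ g ∈ P, ∀ h ∈ P, g ≠ h → g.1 ≠ h.1 ∧ g.1 ≠ h.2 ∧ g.2 ≠ h.1 ∧ g.2 ≠ h.2

omit [Fintype Q] [DecidableEq Q] in
theorem IsLayer.subset {P P' : Finset (Q × Q)} (h : IsLayer P) (hP : P' ⊆ P) : IsLayer P' :=
  ⟨fun g hg => h.ne g (hP hg), fun g hg k hk => h.disjoint g (hP hg) k (hP hk)⟩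

theorem layerOp_congr (P : Finset (Q × Q))
    {u v : Q × Q → Matrix (Fin 2 × Fin 2) (Fin 2 × Fin 2) ℂ} (h : ∀ g ∈ P, u g = v g) :
    layerOp P u = layerOp P v := by
  funext x y
  unfold layerOp
  congr 1
  exact Finset.prod_congr rfl fun g hg => by rw [h g hg]

theorem layerOp_empty (u : Q × Q → Matrix (Fin 2 × Fin 2) (Fin 2 × Fin 2) ℂ) :
    layerOp ∅ u = (1 : Op Q) := by
  ext x y
  simp only [layerOp, Finset.prod_empty, one_mul, Finset.notMem_empty, false_imp_iff, implies_true,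
    Finset.filter_true, Matrix.one_apply]
  by_cases h : x = y
  · subst h; simp
  · obtain ⟨c, hc⟩ := Function.ne_iff.mp h
    rw [if_neg h]
    exact Finset.prod_eq_zero (Finset.mem_univ c) (if_neg hc)

theorem supportedOn_layerOp (P : Finset (Q × Q))
    (u : Q × Q → Matrix (Fin 2 × Fin 2) (Fin 2 × Fin 2) ℂ) {X : Set Q}
    (hX : ∀ g ∈ P, g.1 ∈ X ∧ g.2 ∈ X) : SupportedOn X (layerOp P u) := by
  refine ⟨fun x y c hc hxy => ?_, fun d hd x y => ?_⟩
  · unfold layerOp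
    rw [Finset.prod_eq_zero (i := c) _ (if_neg hxy), mul_zero]
    rw [Finset.mem_filter]
    exact ⟨Finset.mem_univ c, fun g hg => ⟨fun h => hc (h ▸ (hX g hg).1),
      fun h => hc (h ▸ (hX g hg).2)⟩⟩
  · unfold layerOp
    congr 1
    · refine Finset.prod_congr rfl fun g hg => ?_
      simp only [Pi.add_apply, hd _ (hX g hg).1, hd _ (hX g hg).2, add_zero]
    · simp only [Pi.add_apply, add_left_inj]

theorem layerOp_conjTranspose (P : Finset (Q × Q))
    (u : Q × Q → Matrix (Fin 2 × Fin 2) (Fin 2 × Fin 2) ℂ) :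
    (layerOp P u)ᴴ = layerOp P fun g => (u g)ᴴ := by
  ext x y
  simp only [layerOp, Matrix.conjTranspose_apply, star_mul', star_prod]
  congr 1
  refine Finset.prod_congr rfl fun c _ => ?_
  by_cases h : x c = y c
  · simp [h]
  · simp [h, Ne.symm h]

/-- A layer is the product of the operators of two complementary sets of its gates. -/
theorem layerOp_union {P₁ P₂ : Finset (Q × Q)} (hP : IsLayer (P₁ ∪ P₂)) (hd : Disjoint P₁ P₂)
    (u : Q × Q → Matrix (Fin 2 × Fin 2) (Fin 2 × Fin 2) ℂ) :
    layerOp (P₁ ∪ P₂) u = layerOp P₁ u * layerOp P₂ u := by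
  classical
  ext x y
  -- The only path from `x` to `y` that contributes first moves the qubits of `P₁`.
  set z : Q → Fin 2 := fun c => if ∃ g ∈ P₁, c = g.1 ∨ c = g.2 then y c else x c with hz
  have hz1 : ∀ c, (∃ g ∈ P₁, c = g.1 ∨ c = g.2) → z c = y c := fun c hc => if_pos hc
  have hz2 : ∀ c, (¬ ∃ g ∈ P₁, c = g.1 ∨ c = g.2) → z c = x c := fun c hc => if_neg hc
  have hsep : ∀ g ∈ P₂, ∀ c, (c = g.1 ∨ c = g.2) → ¬ ∃ h ∈ P₁, c = h.1 ∨ c = h.2 := by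
    rintro g hg c hc ⟨h, hh, hch⟩
    have hne : g ≠ h := fun e => Finset.disjoint_left.mp hd hh (e ▸ hg)
    obtain ⟨h1, h2, h3, h4⟩ := hP.disjoint g (Finset.mem_union_right _ hg) h
      (Finset.mem_union_left _ hh) hne
    rcases hc with rfl | rfl <;> rcases hch with hch | hch <;> contradiction
  rw [Matrix.mul_apply, Finset.sum_eq_single z]
  · unfold layerOp
    rw [Finset.prod_union hd]
    have e1 : ∏ g ∈ P₁, u g (x g.1, x g.2) (z g.1, z g.2) =
        ∏ g ∈ P₁, u g (x g.1, x g.2) (y g.1, y g.2) :=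
      Finset.prod_congr rfl fun g hg => by
        rw [hz1 g.1 ⟨g, hg, Or.inl rfl⟩, hz1 g.2 ⟨g, hg, Or.inr rfl⟩]
    have e2 : ∏ g ∈ P₂, u g (z g.1, z g.2) (y g.1, y g.2) =
        ∏ g ∈ P₂, u g (x g.1, x g.2) (y g.1, y g.2) :=
      Finset.prod_congr rfl fun g hg => by
        rw [hz2 g.1 (hsep g hg _ (Or.inl rfl)), hz2 g.2 (hsep g hg _ (Or.inr rfl))]
    have e3 : (∏ c : Q with ∀ g ∈ P₁, c ≠ g.1 ∧ c ≠ g.2,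
        if x c = z c then (1 : ℂ) else 0) = 1 := by
      refine Finset.prod_eq_one fun c hc => if_pos (hz2 c ?_).symm
      rintro ⟨g, hg, h⟩
      have := (Finset.mem_filter.mp hc).2 g hg
      tauto
    have e4 : (∏ c : Q with ∀ g ∈ P₂, c ≠ g.1 ∧ c ≠ g.2, if z c = y c then (1 : ℂ) else 0) =
        ∏ c : Q with ∀ g ∈ P₁ ∪ P₂, c ≠ g.1 ∧ c ≠ g.2, if x c = y c then (1 : ℂ) else 0 := by
      rw [Finset.prod_filter, Finset.prod_filter]
      refine Finset.prod_congr rfl fun c _ => ?_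
      by_cases h1 : ∃ g ∈ P₁, c = g.1 ∨ c = g.2
      · rw [hz1 c h1, if_pos rfl, ite_self, if_neg]
        intro h
        obtain ⟨g, hg, hc⟩ := h1
        have := h g (Finset.mem_union_left _ hg)
        tauto
      · rw [hz2 c h1]
        congr 1
        refine propext ⟨fun h g hg => ?_, fun h g hg => h g (Finset.mem_union_right _ hg)⟩
        rcases Finset.mem_union.mp hg with hg | hg
        · exact ⟨fun e => h1 ⟨g, hg, Or.inl e⟩, fun e => h1 ⟨g, hg, Or.inr e⟩⟩
        · exact h g hg
    rw [e1, e2, e3, e4]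
    ring
  · intro w _ hw
    obtain ⟨c, hc⟩ := Function.ne_iff.mp hw
    by_cases h1 : ∃ g ∈ P₁, c = g.1 ∨ c = g.2
    · rw [hz1 c h1] at hc
      rw [(supportedOn_layerOp P₂ u (X := {c | ∃ g ∈ P₂, c = g.1 ∨ c = g.2})
        fun g hg => ⟨⟨g, hg, Or.inl rfl⟩, ⟨g, hg, Or.inr rfl⟩⟩).eq_zero w y c ?_ hc, mul_zero]
      rintro ⟨g, hg, h⟩
      exact hsep g hg c h h1
    · rw [hz2 c h1] at hc
      rw [(supportedOn_layerOp P₁ u (X := {c | ∃ g ∈ P₁, c = g.1 ∨ c = g.2})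
        fun g hg => ⟨⟨g, hg, Or.inl rfl⟩, ⟨g, hg, Or.inr rfl⟩⟩).eq_zero x w c h1 hc.symm, zero_mul]
  · exact fun h => absurd (Finset.mem_univ z) h

theorem layerOp_singleton_mul (g : Q × Q) (hg : g.1 ≠ g.2)
    (u v : Q × Q → Matrix (Fin 2 × Fin 2) (Fin 2 × Fin 2) ℂ) :
    layerOp {g} u * layerOp {g} v = layerOp {g} fun h => u h * v h := by
  ext x y
  rw [Matrix.mul_apply]
  simp only [layerOp, Finset.prod_singleton, Finset.mem_singleton, forall_eq, Matrix.mul_apply]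
  set e : Fin 2 × Fin 2 → Q → Fin 2 := fun s c =>
    if c = g.1 then s.1 else if c = g.2 then s.2 else x c
    with he
  have he1 : ∀ s, e s g.1 = s.1 := fun s => if_pos rfl
  have he2 : ∀ s, e s g.2 = s.2 := fun s => by simp [he, hg.symm]
  have he3 : ∀ s c, c ≠ g.1 → c ≠ g.2 → e s c = x c := fun s c h1 h2 => by simp [he, h1, h2]
  rw [Finset.sum_mul]
  symm
  refine Fintype.sum_of_injective e (fun s t hst => ?_) _ _ (fun z hz => ?_) (fun s => ?_)
  · refine Prod.ext ?_ ?_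
    · rw [← he1 s, hst, he1]
    · rw [← he2 s, hst, he2]
  · -- A configuration outside the range differs from `x` away from the gate.
    have : ∃ c, c ≠ g.1 ∧ c ≠ g.2 ∧ x c ≠ z c := by
      by_contra! h
      refine hz ⟨(z g.1, z g.2), funext fun c => ?_⟩
      by_cases h1 : c = g.1
      · rw [h1, he1]
      · by_cases h2 : c = g.2
        · rw [h2, he2]
        · rw [he3 _ c h1 h2, h c h1 h2]
    obtain ⟨c, h1, h2, hc⟩ := this
    rw [Finset.prod_eq_zero (i := c) (by simp [h1, h2]) (if_neg hc), mul_zero, zero_mul]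
  · have e1 : (∏ c : Q with c ≠ g.1 ∧ c ≠ g.2, if x c = e s c then (1 : ℂ) else 0) = 1 := by
      refine Finset.prod_eq_one fun c hc => ?_
      rw [Finset.mem_filter] at hc
      rw [he3 s c hc.2.1 hc.2.2, if_pos rfl]
    have e2 : (∏ c : Q with c ≠ g.1 ∧ c ≠ g.2, if e s c = y c then (1 : ℂ) else 0) =
        ∏ c : Q with c ≠ g.1 ∧ c ≠ g.2, if x c = y c then (1 : ℂ) else 0 := by
      refine Finset.prod_congr rfl fun c hc => ?_
      rw [Finset.mem_filter] at hc
      rw [he3 s c hc.2.1 hc.2.2]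
    rw [e1, e2, he1, he2]
    ring

theorem layerOp_conjTranspose_mul_self {P : Finset (Q × Q)} (hP : IsLayer P)
    {u : Q × Q → Matrix (Fin 2 × Fin 2) (Fin 2 × Fin 2) ℂ} (hu : ∀ g ∈ P, (u g)ᴴ * u g = 1) :
    (layerOp P u)ᴴ * layerOp P u = 1 := by
  induction P using Finset.induction_on with
  | empty => rw [layerOp_empty, Matrix.conjTranspose_one, one_mul]
  | insert g P hg ih =>
    have h1 := ih (hP.subset (Finset.subset_insert g P))
      fun h hh => hu h (Finset.mem_insert_of_mem hh)
    have h2 : (layerOp {g} u)ᴴ * layerOp {g} u = 1 := by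
      rw [layerOp_conjTranspose, layerOp_singleton_mul g (hP.ne g (Finset.mem_insert_self g P)),
        layerOp_congr {g} (v := fun _ => 1) fun h hh => ?_]
      · ext x y
        simp only [layerOp, Finset.prod_singleton, Finset.mem_singleton, forall_eq,
          Matrix.one_apply, Prod.mk.injEq]
        by_cases h : x = y
        · subst h; simp
        · obtain ⟨c, hc⟩ := Function.ne_iff.mp h
          rw [if_neg h]
          by_cases hcg : c = g.1 ∨ c = g.2
          · rw [if_neg, zero_mul]
            rintro ⟨ha, hb⟩
            rcases hcg with rfl | rfl <;> contradiction
          · push Not at hcg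
            rw [Finset.prod_eq_zero (i := c) (by simp [hcg.1, hcg.2]) (if_neg hc), mul_zero]
      · rw [Finset.mem_singleton.mp hh]
        exact hu g (Finset.mem_insert_self g P)
    rw [Finset.insert_eq] at hP ⊢
    rw [layerOp_union hP (Finset.disjoint_singleton_left.mpr hg), Matrix.conjTranspose_mul]
    calc (layerOp P u)ᴴ * (layerOp {g} u)ᴴ * (layerOp {g} u * layerOp P u)
        = (layerOp P u)ᴴ * ((layerOp {g} u)ᴴ * layerOp {g} u) * layerOp P u := by
          simp only [Matrix.mul_assoc]
      _ = 1 := by rw [h2, Matrix.mul_one, h1]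

/-- Causality of a layer in the Heisenberg picture: if `O` is supported on `X`, then the gates that
do not touch `X` cancel in `Uᴴ O U`, and the others enlarge the support by their qubits only. -/
theorem exists_supportedOn_conj_layerOp {P : Finset (Q × Q)} (hP : IsLayer P)
    {u v : Q × Q → Matrix (Fin 2 × Fin 2) (Fin 2 × Fin 2) ℂ}
    (hu : ∀ g ∈ P, (u g)ᴴ * u g = 1) (hv : ∀ g ∈ P, (v g)ᴴ * v g = 1) {X Y : Set Q} (hXY : X ⊆ Y)
    (hY : ∀ g ∈ P, g.1 ∈ X ∨ g.2 ∈ X → g.1 ∈ Y ∧ g.2 ∈ Y)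
    (huv : ∀ g ∈ P, g.1 ∈ X ∨ g.2 ∈ X → u g = v g) {O : Op Q} (hO : SupportedOn X O) :
    ∃ O', SupportedOn Y O' ∧ (layerOp P u)ᴴ * O * layerOp P u = O' ∧
      (layerOp P v)ᴴ * O * layerOp P v = O' := by
  classical
  set P₁ := P.filter fun g => g.1 ∈ X ∨ g.2 ∈ X with hP₁
  set P₂ := P.filter fun g => ¬ (g.1 ∈ X ∨ g.2 ∈ X) with hP₂
  have hunion : P₁ ∪ P₂ = P := Finset.filter_union_filter_not_eq _ P
  have hdisj : Disjoint P₁ P₂ := Finset.disjoint_filter_filter_not P P _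
  set Z : Set Q := X ∪ {c | ∃ g ∈ P₁, c = g.1 ∨ c = g.2} with hZ
  set W : Set Q := {c | ∃ g ∈ P₂, c = g.1 ∨ c = g.2} with hW
  have hZW : Disjoint Z W := by
    rw [Set.disjoint_right]
    rintro c ⟨g, hg, hc⟩ (hcX | ⟨h, hh, hch⟩)
    · have := (Finset.mem_filter.mp hg).2
      rcases hc with rfl | rfl <;> tauto
    · have hne : g ≠ h := fun e => Finset.disjoint_left.mp hdisj hh (e ▸ hg)
      obtain ⟨h1, h2, h3, h4⟩ := hP.disjoint g (Finset.mem_filter.mp hg).1 h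
        (Finset.mem_filter.mp hh).1 hne
      rcases hc with rfl | rfl <;> rcases hch with hch | hch <;> contradiction
  have key : ∀ w : Q × Q → Matrix (Fin 2 × Fin 2) (Fin 2 × Fin 2) ℂ,
      (∀ g ∈ P, (w g)ᴴ * w g = 1) → SupportedOn Z ((layerOp P₁ w)ᴴ * O * layerOp P₁ w) ∧
      (layerOp P w)ᴴ * O * layerOp P w = (layerOp P₁ w)ᴴ * O * layerOp P₁ w := by
    intro w hw
    have hs1 : SupportedOn Z (layerOp P₁ w) := supportedOn_layerOp P₁ w fun g hg =>
      ⟨Or.inr ⟨g, hg, Or.inl rfl⟩, Or.inr ⟨g, hg, Or.inr rfl⟩⟩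
    have hs2 : SupportedOn W (layerOp P₂ w) := supportedOn_layerOp P₂ w fun g hg =>
      ⟨⟨g, hg, Or.inl rfl⟩, ⟨g, hg, Or.inr rfl⟩⟩
    have hs := (hs1.conjTranspose.mul (hO.mono Set.subset_union_left)).mul hs1
    refine ⟨hs, ?_⟩
    have hU : layerOp P w = layerOp P₁ w * layerOp P₂ w := by
      rw [← layerOp_union (hunion ▸ hP) hdisj, hunion]
    have h2 : (layerOp P₂ w)ᴴ * layerOp P₂ w = 1 :=
      layerOp_conjTranspose_mul_self (hP.subset (Finset.filter_subset _ _))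
        fun g hg => hw g (Finset.mem_filter.mp hg).1
    rw [hU, Matrix.conjTranspose_mul]
    calc (layerOp P₂ w)ᴴ * (layerOp P₁ w)ᴴ * O * (layerOp P₁ w * layerOp P₂ w)
        = (layerOp P₂ w)ᴴ * (((layerOp P₁ w)ᴴ * O * layerOp P₁ w) * layerOp P₂ w) := by
          simp only [Matrix.mul_assoc]
      _ = ((layerOp P₂ w)ᴴ * layerOp P₂ w) * ((layerOp P₁ w)ᴴ * O * layerOp P₁ w) := by
          rw [hs.commute hs2 hZW, Matrix.mul_assoc (layerOp P₂ w)ᴴ]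
      _ = _ := by rw [h2, Matrix.one_mul]
  refine ⟨(layerOp P₁ u)ᴴ * O * layerOp P₁ u, (key u hu).1.mono ?_, (key u hu).2, ?_⟩
  · rintro c (hc | ⟨g, hg, hc⟩)
    · exact hXY hc
    · obtain ⟨hgP, hgX⟩ := Finset.mem_filter.mp hg
      have := hY g hgP hgX
      rcases hc with rfl | rfl
      exacts [this.1, this.2]
  · rw [(key v hv).2, layerOp_congr P₁ fun g hg =>
      (huv g (Finset.mem_filter.mp hg).1 (Finset.mem_filter.mp hg).2).symm]

/-! ### The noise layer -/

theorem depolarize_single_apply (p : ℝ) (u v x y : Fin 2) :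
    depolarize p (Matrix.single u v 1) x y =
      (1 - p : ℂ) * (if u = x ∧ v = y then 1 else 0) +
        (p : ℂ) / 2 * (if u = v then 1 else 0) * (if x = y then 1 else 0) := by
  simp only [depolarize, Matrix.add_apply, Matrix.smul_apply, Matrix.single_apply, Matrix.one_apply,
    smul_eq_mul, Complex.ofReal_sub, Complex.ofReal_one]
  by_cases h : u = v
  · subst h; simp
  · rw [Matrix.trace_single_eq_of_ne u v 1 h]; simp [h]

theorem depolarize_single_symm (p : ℝ) (u v x y : Fin 2) :
    depolarize p (Matrix.single u v 1) x y = depolarize p (Matrix.single y x 1) v u := by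
  simp only [depolarize_single_apply, eq_comm, and_comm]
  ring

/-- The kernel of the depolarizing channel is invariant under flipping all of its bits, that is, the
channel commutes with conjugation by the Pauli operator `X`. -/
theorem depolarize_single_shift (p : ℝ) (d u v x y : Fin 2) :
    depolarize p (Matrix.single (u + d) (v + d) 1) (x + d) (y + d) =
      depolarize p (Matrix.single u v 1) x y := by
  simp only [depolarize_single_apply, add_left_inj]

/-- The noise layer is its own dual under the trace pairing. -/
theorem trace_mul_noiseLayer (p : ℝ) (O σ : Op Q) :
    (O * noiseLayer p σ).trace = (noiseLayer p O * σ).trace := by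
  have hl : (O * noiseLayer p σ).trace = ∑ x : Q → Fin 2, ∑ y : Q → Fin 2, ∑ u : Q → Fin 2,
      ∑ v : Q → Fin 2, O x y * ((∏ s, depolarize p (Matrix.single (u s) (v s) 1) (y s) (x s)) *
        σ u v) := by
    simp only [Matrix.trace, Matrix.diag_apply, Matrix.mul_apply, noiseLayer, Finset.mul_sum]
  have hr : (noiseLayer p O * σ).trace = ∑ v : Q → Fin 2, ∑ u : Q → Fin 2, ∑ x : Q → Fin 2,
      ∑ y : Q → Fin 2, ((∏ s, depolarize p (Matrix.single (x s) (y s) 1) (v s) (u s)) * O x y) *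
        σ u v := by
    simp only [Matrix.trace, Matrix.diag_apply, Matrix.mul_apply, noiseLayer, Finset.sum_mul]
  have hcomm : ∀ F : (Q → Fin 2) → (Q → Fin 2) → (Q → Fin 2) → (Q → Fin 2) → ℂ,
      ∑ x, ∑ y, ∑ u, ∑ v, F x y u v = ∑ v, ∑ u, ∑ x, ∑ y, F x y u v := fun F => by
    calc ∑ x, ∑ y, ∑ u, ∑ v, F x y u v
        = ∑ a : (Q → Fin 2) × (Q → Fin 2), ∑ b : (Q → Fin 2) × (Q → Fin 2), F a.1 a.2 b.1 b.2 := by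
          simp only [Fintype.sum_prod_type]
      _ = ∑ b : (Q → Fin 2) × (Q → Fin 2), ∑ a : (Q → Fin 2) × (Q → Fin 2), F a.1 a.2 b.1 b.2 :=
          Finset.sum_comm
      _ = ∑ u, ∑ v, ∑ x, ∑ y, F x y u v := by simp only [Fintype.sum_prod_type]
      _ = _ := Finset.sum_comm
  rw [hl, hr, hcomm]
  refine Finset.sum_congr rfl fun v _ => Finset.sum_congr rfl fun u _ =>
    Finset.sum_congr rfl fun x _ => Finset.sum_congr rfl fun y _ => ?_
  rw [Finset.prod_congr rfl fun s _ => depolarize_single_symm p (u s) (v s) (y s) (x s)]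
  ring

theorem SupportedOn.noiseLayer (p : ℝ) {X : Set Q} {O : Op Q} (hO : SupportedOn X O) :
    SupportedOn X (noiseLayer p O) := by
  refine ⟨fun x y c hc hxy => ?_, fun d hd x y => ?_⟩
  · refine Finset.sum_eq_zero fun u _ => Finset.sum_eq_zero fun v _ => ?_
    by_cases huv : u c = v c
    · rw [Finset.prod_eq_zero (Finset.mem_univ c), zero_mul]
      rw [depolarize_single_apply, if_neg, if_neg hxy, mul_zero, mul_zero, add_zero]
      rintro ⟨h1, h2⟩
      exact hxy (h1.symm.trans (huv.trans h2))
    · rw [hO.eq_zero u v c hc huv, mul_zero]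
  · unfold NoisyCircuit.noiseLayer
    refine (Fintype.sum_equiv (Equiv.addRight d) _ _ fun u => ?_).symm
    refine Fintype.sum_equiv (Equiv.addRight d) _ _ fun v => ?_
    simp only [Equiv.coe_addRight, Pi.add_apply, depolarize_single_shift, hO.shift d hd]

/-- Kraus operators of the one-qubit depolarizing channel: a multiple of the identity, and
multiples of the four matrix units. -/
def depolarizeKraus (p : ℝ) : Option (Fin 2 × Fin 2) → Matrix (Fin 2) (Fin 2) ℂ
  | none => fun x u => if u = x then (Real.sqrt (1 - p) : ℂ) else 0
  | some a => fun x u => if x = a.1 ∧ u = a.2 then (Real.sqrt (p / 2) : ℂ) else 0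

theorem depolarize_single_eq_sum_kraus {p : ℝ} (hp : p ∈ Set.Icc (0 : ℝ) 1) (u v x y : Fin 2) :
    depolarize p (Matrix.single u v 1) x y =
      ∑ a, depolarizeKraus p a x u * star (depolarizeKraus p a y v) := by
  have h1 : ((Real.sqrt (1 - p) : ℂ)) * (Real.sqrt (1 - p) : ℂ) = 1 - p := by
    rw [← Complex.ofReal_mul, Real.mul_self_sqrt (by linarith [hp.2])]
    simp
  have h2 : ((Real.sqrt (p / 2) : ℂ)) * (Real.sqrt (p / 2) : ℂ) = p / 2 := by
    rw [← Complex.ofReal_mul, Real.mul_self_sqrt (by linarith [hp.1])]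
    simp
  rw [depolarize_single_apply, Fintype.sum_option, Fintype.sum_prod_type]
  simp only [depolarizeKraus, Fin.sum_univ_two]
  have h3 : star (Real.sqrt (1 - p) : ℂ) = Real.sqrt (1 - p) := Complex.conj_ofReal _
  have h4 : star (Real.sqrt (p / 2) : ℂ) = Real.sqrt (p / 2) := Complex.conj_ofReal _
  generalize (Real.sqrt (1 - p) : ℂ) = a at *
  generalize (Real.sqrt (p / 2) : ℂ) = b at *
  fin_cases u <;> fin_cases v <;> fin_cases x <;> fin_cases y <;>
    simp [h1, h2, h3, h4]

theorem noiseLayer_eq_sum_kraus {p : ℝ} (hp : p ∈ Set.Icc (0 : ℝ) 1) (σ : Op Q) :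
    noiseLayer p σ = ∑ a : Q → Option (Fin 2 × Fin 2),
      (Matrix.of fun x u : Q → Fin 2 => ∏ s, depolarizeKraus p (a s) (x s) (u s)) * σ *
        (Matrix.of fun x u : Q → Fin 2 => ∏ s, depolarizeKraus p (a s) (x s) (u s))ᴴ := by
  ext x y
  simp only [Matrix.sum_apply, Matrix.mul_apply, Matrix.conjTranspose_apply, Matrix.of_apply,
    noiseLayer, depolarize_single_eq_sum_kraus hp, Finset.prod_univ_sum, Fintype.piFinset_univ,
    Finset.sum_mul, star_prod]
  simp only [Finset.prod_mul_distrib]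
  have hcomm : ∀ F : (Q → Fin 2) → (Q → Fin 2) → (Q → Option (Fin 2 × Fin 2)) → ℂ,
      ∑ u, ∑ v, ∑ a, F u v a = ∑ a, ∑ v, ∑ u, F u v a := fun F => by
    calc ∑ u, ∑ v, ∑ a, F u v a = ∑ u, ∑ a, ∑ v, F u v a :=
          Finset.sum_congr rfl fun u _ => Finset.sum_comm
      _ = ∑ a, ∑ u, ∑ v, F u v a := Finset.sum_comm
      _ = _ := Finset.sum_congr rfl fun a _ => Finset.sum_comm
  rw [hcomm]
  refine Finset.sum_congr rfl fun a _ => Finset.sum_congr rfl fun v _ =>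
    Finset.sum_congr rfl fun u _ => ?_
  ring

theorem IsState.noiseLayer {p : ℝ} (hp : p ∈ Set.Icc (0 : ℝ) 1) {ρ : Op Q} (hρ : IsState ρ) :
    IsState (noiseLayer p ρ) := by
  constructor
  · rw [noiseLayer_eq_sum_kraus hp]
    exact Matrix.posSemidef_sum _ fun a _ => hρ.1.mul_mul_conjTranspose_same _
  · have hone : NoisyCircuit.noiseLayer p (1 : Op Q) = 1 := by
      ext x y
      have h : NoisyCircuit.noiseLayer p (1 : Op Q) x y =
          ∏ s, ∑ u : Fin 2, depolarize p (Matrix.single u u 1) (x s) (y s) := by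
        simp only [NoisyCircuit.noiseLayer, Matrix.one_apply, mul_ite, mul_one, mul_zero,
          Finset.sum_ite_eq, Finset.mem_univ, if_true, Finset.prod_univ_sum, Fintype.piFinset_univ]
      have h' : ∀ a b : Fin 2, ∑ u : Fin 2, depolarize p (Matrix.single u u 1) a b =
          if a = b then 1 else 0 := by
        intro a b
        simp only [depolarize_single_apply, Fin.sum_univ_two]
        fin_cases a <;> fin_cases b <;> simp <;> ring
      rw [h]
      simp only [h', Matrix.one_apply]
      by_cases hxy : x = y
      · subst hxy; simp
      · obtain ⟨c, hc⟩ := Function.ne_iff.mp hxy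
        rw [if_neg hxy, Finset.prod_eq_zero (Finset.mem_univ c) (if_neg hc)]
    have h := trace_mul_noiseLayer p 1 ρ
    rw [Matrix.one_mul, hone, Matrix.one_mul] at h
    rw [h, hρ.2]

theorem IsState.conj {ρ U : Op Q} (hρ : IsState ρ) (hU : Uᴴ * U = 1) :
    IsState (U * ρ * Uᴴ) := by
  refine ⟨hρ.1.mul_mul_conjTranspose_same U, ?_⟩
  rw [Matrix.trace_mul_comm, ← Matrix.mul_assoc, hU, Matrix.one_mul, hρ.2]

/-- The diagonal of a state is a probability distribution. -/
theorem IsState.sum_mul_diag_mem_Icc {ρ : Op Q} (hρ : IsState ρ) {f : (Q → Fin 2) → ℝ}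
    (hf : ∀ x, f x ∈ Set.Icc (0 : ℝ) 1) : ∑ x, f x * (ρ x x).re ∈ Set.Icc (0 : ℝ) 1 := by
  have h0 : ∀ x, 0 ≤ (ρ x x).re := fun x => (Complex.le_def.mp hρ.1.diag_nonneg).1
  have h1 : ∑ x, (ρ x x).re = 1 := by
    have h := congrArg Complex.re hρ.2
    rw [Complex.one_re, Matrix.trace, Complex.re_sum] at h
    exact h
  refine ⟨Finset.sum_nonneg fun x _ => mul_nonneg (hf x).1 (h0 x), ?_⟩
  rw [← h1]
  exact Finset.sum_le_sum fun x _ => mul_le_of_le_one_left (h0 x) (hf x).2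

/-! ### Locality of channels in the Heisenberg picture -/

/-- The maps `T` and `T'` have the same dual on observables supported on `X`, and the dual maps
these observables to observables supported on `Y`. -/
def LocallyEqual (Y X : Set Q) (T T' : Op Q → Op Q) : Prop :=
  ∀ O, SupportedOn X O → ∃ O', SupportedOn Y O' ∧
    ∀ σ, (O * T σ).trace = (O' * σ).trace ∧ (O * T' σ).trace = (O' * σ).trace

theorem LocallyEqual.comp {X Y Z : Set Q} {S S' T T' : Op Q → Op Q} (hT : LocallyEqual Y X T T')
    (hS : LocallyEqual Z Y S S') : LocallyEqual Z X (fun σ => T (S σ)) (fun σ => T' (S' σ)) := by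
  intro O hO
  obtain ⟨O₁, hO₁, h₁⟩ := hT O hO
  obtain ⟨O₂, hO₂, h₂⟩ := hS O₁ hO₁
  exact ⟨O₂, hO₂, fun σ => ⟨(h₁ _).1.trans (h₂ σ).1, (h₁ _).2.trans (h₂ σ).2⟩⟩

theorem locallyEqual_noiseLayer (p : ℝ) (X : Set Q) :
    LocallyEqual X X (noiseLayer p) (noiseLayer p) := fun O hO =>
  ⟨noiseLayer p O, hO.noiseLayer p, fun σ => ⟨trace_mul_noiseLayer p O σ,
    trace_mul_noiseLayer p O σ⟩⟩

theorem locallyEqual_conj_layerOp {P : Finset (Q × Q)} (hP : IsLayer P)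
    {u v : Q × Q → Matrix (Fin 2 × Fin 2) (Fin 2 × Fin 2) ℂ}
    (hu : ∀ g ∈ P, (u g)ᴴ * u g = 1) (hv : ∀ g ∈ P, (v g)ᴴ * v g = 1) {X Y : Set Q} (hXY : X ⊆ Y)
    (hY : ∀ g ∈ P, g.1 ∈ X ∨ g.2 ∈ X → g.1 ∈ Y ∧ g.2 ∈ Y)
    (huv : ∀ g ∈ P, g.1 ∈ X ∨ g.2 ∈ X → u g = v g) :
    LocallyEqual Y X (fun σ => layerOp P u * σ * (layerOp P u)ᴴ)
      (fun σ => layerOp P v * σ * (layerOp P v)ᴴ) := by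
  intro O hO
  obtain ⟨O', hO', h1, h2⟩ := exists_supportedOn_conj_layerOp hP hu hv hXY hY huv hO
  have cyc : ∀ U σ : Op Q, (O * (U * σ * Uᴴ)).trace = (Uᴴ * O * U * σ).trace := fun U σ => by
    rw [← Matrix.mul_assoc, Matrix.trace_mul_comm]
    simp only [Matrix.mul_assoc]
  exact ⟨O', hO', fun σ => ⟨by rw [cyc, h1], by rw [cyc, h2]⟩⟩

/-- The light cone of a sequence of steps grows by one step of the family `B` per step. -/
theorem locallyEqual_foldl {ι : Type*} (B : ℕ → Set Q) (T T' : ι → Op Q → Op Q) (R : ℕ)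
    (hT : ∀ t, ∀ r < R, LocallyEqual (B (r + 1)) (B r) (T t) (T' t)) (l : List ι) (r : ℕ)
    (hr : r + l.length ≤ R) :
    LocallyEqual (B (r + l.length)) (B r) (fun σ => l.foldl (fun σ t => T t σ) σ)
      (fun σ => l.foldl (fun σ t => T' t σ) σ) := by
  induction l with
  | nil => exact fun O hO => ⟨O, hO, fun σ => ⟨rfl, rfl⟩⟩
  | cons t l ih =>
    simp only [List.foldl_cons, List.length_cons] at hr ⊢
    exact (ih (by omega)).comp (hT t (r + l.length) (by omega))

end Register

/-! ### Balls in the lattice -/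

section Lattice

variable {k : ℕ} {L : Fin k → ℕ}

/-- The sites that are reached from `v` by moving at most `r` steps in each coordinate
direction. -/
def ball (r : ℕ) (v : Site k L) : Finset (Site k L) :=
  (Fintype.piFinset fun _ : Fin k => Finset.Icc (-(r : ℤ)) r).image fun z i =>
    v i + (z i : ZMod (L i))

theorem mem_ball {r : ℕ} {v w : Site k L} :
    w ∈ ball r v ↔ ∃ z : Fin k → ℤ, (∀ i, |z i| ≤ r) ∧ ∀ i, w i = v i + (z i : ZMod (L i)) := by
  simp only [ball, Finset.mem_image, Fintype.mem_piFinset, Finset.mem_Icc, ← abs_le]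
  exact exists_congr fun z => and_congr_right fun _ => ⟨fun h i => (congrFun h i).symm,
    fun h => funext fun i => (h i).symm⟩

theorem mem_ball_self (r : ℕ) (v : Site k L) : v ∈ ball r v :=
  mem_ball.mpr ⟨0, fun i => by simp, fun i => by simp⟩

theorem mem_ball_comm {r : ℕ} {v w : Site k L} (h : w ∈ ball r v) : v ∈ ball r w := by
  obtain ⟨z, hz, hw⟩ := mem_ball.mp h
  exact mem_ball.mpr ⟨-z, fun i => by simpa using hz i, fun i => by simp [hw i]⟩

theorem mem_ball_add {r s : ℕ} {u v w : Site k L} (h : w ∈ ball r v) (h' : u ∈ ball s w) :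
    u ∈ ball (r + s) v := by
  obtain ⟨z, hz, hw⟩ := mem_ball.mp h
  obtain ⟨y, hy, hu⟩ := mem_ball.mp h'
  refine mem_ball.mpr ⟨z + y, fun i => ?_, fun i => ?_⟩
  · rw [Pi.add_apply, Nat.cast_add]
    exact (abs_add_le _ _).trans (add_le_add (hz i) (hy i))
  · rw [hu i, hw i, Pi.add_apply, Int.cast_add, add_assoc]

theorem ball_mono {r s : ℕ} (h : r ≤ s) (v : Site k L) : ball r v ⊆ ball s v := by
  intro w hw
  obtain ⟨z, hz, hw⟩ := mem_ball.mp hw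
  exact mem_ball.mpr ⟨z, fun i => (hz i).trans (by exact_mod_cast h), hw⟩

theorem card_ball_le (r : ℕ) (v : Site k L) : (ball r v).card ≤ (2 * r + 1) ^ k := by
  refine Finset.card_image_le.trans (le_of_eq ?_)
  rw [Fintype.card_piFinset, Finset.prod_const, Finset.card_univ, Fintype.card_fin, Int.card_Icc]
  congr 1
  omega

theorem NearestNeighbor.mem_ball_one {a b : Site k L} (h : NearestNeighbor a b) :
    b ∈ ball 1 a ∧ a ∈ ball 1 b := by
  have key : ∀ (c : Site k L) (i : Fin k), c + Pi.single i 1 ∈ ball 1 c := fun c i => by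
    refine mem_ball.mpr ⟨Pi.single i 1, fun j => ?_, fun j => ?_⟩
    · by_cases hj : j = i
      · subst hj; simp
      · simp [hj]
    · by_cases hj : j = i
      · subst hj; simp
      · simp [hj]
  obtain ⟨_, i, rfl | rfl⟩ := h
  · exact ⟨key a i, mem_ball_comm (key a i)⟩
  · exact ⟨mem_ball_comm (key b i), key b i⟩

/-- The sites at distance at most `r` of an endpoint of `e`. -/
def edgeBall (e : Sym2 (Site k L)) (r : ℕ) : Set (Site k L) := {w | ∃ v ∈ e, w ∈ ball r v}

end Lattice

/-! ### The cut value of an edge -/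

section Edge

variable {Q : Type} [Fintype Q] [DecidableEq Q]

/-- The contribution of the edge `e` to the cut value of a computational basis state. -/
def edgeValue (e : Sym2 Q) (x : Q → Fin 2) : ℝ :=
  Sym2.lift ⟨fun i j => (1 - zSign (x i) * zSign (x j)) / 2,
    fun i j => by simp only [mul_comm]⟩ e

omit [Fintype Q] [DecidableEq Q] in
theorem edgeValue_mem_Icc (e : Sym2 Q) (x : Q → Fin 2) : edgeValue e x ∈ Set.Icc (0 : ℝ) 1 := by
  induction e using Sym2.ind with
  | _ i j =>
    simp only [edgeValue, Sym2.lift_mk, zSign]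
    split_ifs <;> norm_num

omit [DecidableEq Q] in
theorem supportedOn_diagonal_edgeValue (e : Sym2 Q) :
    SupportedOn {v | v ∈ e} (Matrix.diagonal fun x => (edgeValue e x : ℂ) : Op Q) := by
  refine SupportedOn.diagonal _ fun d hd x => ?_
  induction e using Sym2.ind with
  | _ i j =>
    have hi : d i = 0 := hd i (Sym2.mem_mk_left i j)
    have hj : d j = 0 := hd j (Sym2.mem_mk_right i j)
    simp [edgeValue, hi, hj]

end Edge

namespace LocalArchitecture

variable {k : ℕ} {L : Fin k → ℕ} {m : ℕ} [∀ i, NeZero (L i)]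

/-! ### Light cones -/

omit [∀ i, NeZero (L i)] in
theorem isLayer_pairs (A : LocalArchitecture k L m) (t : Fin m) : IsLayer (A.pairs t) :=
  ⟨fun g hg => (A.neighbor t g hg).1, A.disjoint t⟩

/-- The gates that act on a site at distance at most the depth from an endpoint of `e`. -/
def lightCone (A : LocalArchitecture k L m) (e : Sym2 (Site k L)) :
    Finset ((t : Fin m) × A.pairs t) :=
  open scoped Classical in
  Finset.univ.filter fun q => q.2.1.1 ∈ edgeBall e A.depth ∨ q.2.1.2 ∈ edgeBall e A.depth

/-- The gates of layer `t`, extended by the identity to all pairs of sites. -/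
def gates (A : LocalArchitecture k L m) (ω : A.Instance) (t : Fin m) (g : Site k L × Site k L) :
    Matrix (Fin 2 × Fin 2) (Fin 2 × Fin 2) ℂ :=
  if h : g ∈ A.pairs t then (ω ⟨t, g, h⟩).1 else 1

theorem unitary_eq_layerOp (A : LocalArchitecture k L m) (ω : A.Instance) (t : Fin m) :
    A.unitary ω t = layerOp (A.pairs t) (A.gates ω t) :=
  layerUnitary_eq_layerOp _ _

omit [∀ i, NeZero (L i)] in
theorem gates_conjTranspose_mul_self (A : LocalArchitecture k L m) (ω : A.Instance) (t : Fin m)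
    (g : Site k L × Site k L) : (A.gates ω t g)ᴴ * A.gates ω t g = 1 := by
  unfold gates
  split_ifs with h
  · exact Matrix.mem_unitaryGroup_iff'.mp (ω ⟨t, g, h⟩).2
  · simp

omit [∀ i, NeZero (L i)] in
theorem gates_mul_conjTranspose_self (A : LocalArchitecture k L m) (ω : A.Instance) (t : Fin m)
    (g : Site k L × Site k L) : A.gates ω t g * (A.gates ω t g)ᴴ = 1 := by
  unfold gates
  split_ifs with h
  · exact Matrix.mem_unitaryGroup_iff.mp (ω ⟨t, g, h⟩).2
  · simp

theorem unitary_conjTranspose_mul_self (A : LocalArchitecture k L m) (ω : A.Instance)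
    (t : Fin m) : (A.unitary ω t)ᴴ * A.unitary ω t = 1 := by
  rw [unitary_eq_layerOp]
  exact layerOp_conjTranspose_mul_self (A.isLayer_pairs t)
    fun g _ => A.gates_conjTranspose_mul_self ω t g

theorem isState_channel (A : LocalArchitecture k L m) {p : ℝ} (hp : p ∈ Set.Icc (0 : ℝ) 1)
    (ω : A.Instance) {ρ : Op (Site k L)} (hρ : IsState ρ) : IsState (A.channel p ω ρ) := by
  have fold : ∀ (T : Fin m → Op (Site k L) → Op (Site k L)),
      (∀ t σ, IsState σ → IsState (T t σ)) → ∀ (l : List (Fin m)) (σ : Op (Site k L)),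
        IsState σ → IsState (l.foldl (fun σ t => T t σ) σ) := by
    intro T hT l
    induction l with
    | nil => exact fun σ hσ => hσ
    | cons t l ih => exact fun σ hσ => ih _ (hT t σ hσ)
  refine fold (fun t σ => noiseLayer p ((A.unitary ω t)ᴴ * σ * A.unitary ω t))
    (fun t σ hσ => IsState.noiseLayer hp ?_) _ _
    (fold (fun t σ => noiseLayer p (A.unitary ω t * σ * (A.unitary ω t)ᴴ))
    (fun t σ hσ => (hσ.conj (A.unitary_conjTranspose_mul_self ω t)).noiseLayer hp) _ _ hρ)
  have h := hσ.conj (U := (A.unitary ω t)ᴴ) (by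
    rw [Matrix.conjTranspose_conjTranspose]
    exact mul_eq_one_comm.mp (A.unitary_conjTranspose_mul_self ω t))
  rwa [Matrix.conjTranspose_conjTranspose] at h

/-- If two circuit instances agree on the light cone of `e`, then the circuits have the same
Heisenberg action on observables supported on `e`. -/
theorem locallyEqual_channel (A : LocalArchitecture k L m) (p : ℝ) (e : Sym2 (Site k L))
    {ω ω' : A.Instance} (h : ∀ q ∈ A.lightCone e, ω q = ω' q) :
    LocallyEqual (edgeBall e A.depth) (edgeBall e 0) (A.channel p ω) (A.channel p ω') := by
  have hsub : ∀ r, edgeBall e r ⊆ edgeBall e (r + 1) := by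
    rintro r w ⟨v, hv, hw⟩
    exact ⟨v, hv, ball_mono r.le_succ v hw⟩
  have hstep : ∀ t r, ∀ g ∈ A.pairs t, g.1 ∈ edgeBall e r ∨ g.2 ∈ edgeBall e r →
      g.1 ∈ edgeBall e (r + 1) ∧ g.2 ∈ edgeBall e (r + 1) := by
    intro t r g hg hgr
    obtain ⟨h1, h2⟩ := (A.neighbor t g hg).mem_ball_one
    rcases hgr with hgr | hgr
    · refine ⟨hsub r hgr, ?_⟩
      obtain ⟨v, hv, hw⟩ := hgr
      exact ⟨v, hv, mem_ball_add hw h1⟩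
    · refine ⟨?_, hsub r hgr⟩
      obtain ⟨v, hv, hw⟩ := hgr
      exact ⟨v, hv, mem_ball_add hw h2⟩
  have hgates : ∀ t, ∀ r < A.depth, ∀ g ∈ A.pairs t,
      g.1 ∈ edgeBall e r ∨ g.2 ∈ edgeBall e r → A.gates ω t g = A.gates ω' t g := by
    intro t r hr g hg hgr
    have hmono : edgeBall e r ⊆ edgeBall e A.depth := by
      rintro w ⟨v, hv, hw⟩
      exact ⟨v, hv, ball_mono hr.le v hw⟩
    unfold gates
    rw [dif_pos hg, dif_pos hg, h]
    classical
    rw [lightCone, Finset.mem_filter]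
    exact ⟨Finset.mem_univ _, hgr.imp (fun h => hmono h) fun h => hmono h⟩
  have hT : ∀ t, ∀ r < A.depth, LocallyEqual (edgeBall e (r + 1)) (edgeBall e r)
      (fun σ => noiseLayer p (A.unitary ω t * σ * (A.unitary ω t)ᴴ))
      (fun σ => noiseLayer p (A.unitary ω' t * σ * (A.unitary ω' t)ᴴ)) := by
    intro t r hr
    simp only [unitary_eq_layerOp]
    exact (locallyEqual_noiseLayer p _).comp (locallyEqual_conj_layerOp (A.isLayer_pairs t)
      (fun g _ => A.gates_conjTranspose_mul_self ω t g)
      (fun g _ => A.gates_conjTranspose_mul_self ω' t g) (hsub r) (hstep t r) (hgates t r hr))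
  have hT' : ∀ t, ∀ r < A.depth, LocallyEqual (edgeBall e (r + 1)) (edgeBall e r)
      (fun σ => noiseLayer p ((A.unitary ω t)ᴴ * σ * A.unitary ω t))
      (fun σ => noiseLayer p ((A.unitary ω' t)ᴴ * σ * A.unitary ω' t)) := by
    intro t r hr
    have := (locallyEqual_noiseLayer p _).comp (locallyEqual_conj_layerOp (A.isLayer_pairs t)
      (u := fun g => (A.gates ω t g)ᴴ) (v := fun g => (A.gates ω' t g)ᴴ)
      (fun g _ => by simpa using A.gates_mul_conjTranspose_self ω t g)
      (fun g _ => by simpa using A.gates_mul_conjTranspose_self ω' t g) (hsub r) (hstep t r)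
      (fun g hg hgr => by rw [hgates t r hr g hg hgr]))
    simpa only [← layerOp_conjTranspose, ← unitary_eq_layerOp,
      Matrix.conjTranspose_conjTranspose] using this
  have h1 := locallyEqual_foldl (edgeBall e) _ _ A.depth hT (List.finRange m) m
    (by rw [List.length_finRange, depth]; omega)
  have h2 := locallyEqual_foldl (edgeBall e) _ _ A.depth hT' (List.finRange m).reverse 0
    (by rw [List.length_reverse, List.length_finRange, depth]; omega)
  rw [List.length_finRange] at h1
  rw [List.length_reverse, List.length_finRange, zero_add] at h2
  rw [depth, two_mul]
  exact h2.comp h1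

/-- The expected contribution of the edge `e` to the cut value at the output of the circuit. -/
def edgeOutput (A : LocalArchitecture k L m) (p : ℝ) (ρ : Op (Site k L)) (e : Sym2 (Site k L))
    (ω : A.Instance) : ℝ :=
  ∑ x, edgeValue e x * (A.channel p ω ρ x x).re

theorem edgeOutput_mem_Icc (A : LocalArchitecture k L m) {p : ℝ} (hp : p ∈ Set.Icc (0 : ℝ) 1)
    {ρ : Op (Site k L)} (hρ : IsState ρ) (e : Sym2 (Site k L)) (ω : A.Instance) :
    A.edgeOutput p ρ e ω ∈ Set.Icc (0 : ℝ) 1 :=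
  (A.isState_channel hp ω hρ).sum_mul_diag_mem_Icc (edgeValue_mem_Icc e)

theorem edgeOutput_dependsOn (A : LocalArchitecture k L m) (p : ℝ) (ρ : Op (Site k L))
    (e : Sym2 (Site k L)) : DependsOn (A.edgeOutput p ρ e) (A.lightCone e : Set _) := by
  intro ω ω' h
  have htr : ∀ σ : Op (Site k L), ∑ x, edgeValue e x * (σ x x).re =
      ((Matrix.diagonal fun x => (edgeValue e x : ℂ)) * σ).trace.re := fun σ => by
    simp [Matrix.trace, Matrix.diagonal_mul]
  have hsupp := (supportedOn_diagonal_edgeValue e).mono (Y := edgeBall e 0)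
    fun v hv => ⟨v, hv, mem_ball_self 0 v⟩
  obtain ⟨O', -, hO'⟩ := A.locallyEqual_channel p e h _ hsupp
  rw [edgeOutput, edgeOutput, htr, htr, (hO' ρ).1, (hO' ρ).2]

/-! ### Averages over the gates -/

theorem measurable_channel_apply (A : LocalArchitecture k L m) (p : ℝ) (ρ : Op (Site k L))
    (x y : Site k L → Fin 2) : Measurable fun ω => A.channel p ω ρ x y := by
  have hU : ∀ t x y, Measurable fun ω => A.unitary ω t x y := by
    intro t x y
    unfold unitary layerUnitary
    refine (Finset.measurable_prod _ fun g _ => ?_).mul_const _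
    have hent : ∀ i j, Measurable fun V : TwoQubitGate => V.1 i j := fun i j =>
      (continuous_subtype_val.matrix_elem i j).measurable
    exact (hent _ _).comp (measurable_pi_apply (⟨t, g⟩ : (t : Fin m) × A.pairs t))
  have hU' : ∀ t x y, Measurable fun ω => (A.unitary ω t)ᴴ x y := fun t x y =>
    (continuous_star.measurable).comp (hU t y x)
  have hmul : ∀ M N : A.Instance → Op (Site k L), (∀ x y, Measurable fun ω => M ω x y) →
      (∀ x y, Measurable fun ω => N ω x y) → ∀ x y, Measurable fun ω => (M ω * N ω) x y := by
    intro M N hM hN x y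
    simp only [Matrix.mul_apply]
    exact Finset.measurable_sum _ fun z _ => (hM x z).mul (hN z y)
  have hnoise : ∀ M : A.Instance → Op (Site k L), (∀ x y, Measurable fun ω => M ω x y) →
      ∀ x y, Measurable fun ω => noiseLayer p (M ω) x y := by
    intro M hM x y
    unfold noiseLayer
    exact Finset.measurable_sum _ fun u _ => Finset.measurable_sum _ fun v _ =>
      (hM u v).const_mul _
  have fold : ∀ (T : A.Instance → Fin m → Op (Site k L) → Op (Site k L)),
      (∀ t (M : A.Instance → Op (Site k L)), (∀ x y, Measurable fun ω => M ω x y) →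
        ∀ x y, Measurable fun ω => T ω t (M ω) x y) →
      ∀ (l : List (Fin m)) (M : A.Instance → Op (Site k L)), (∀ x y, Measurable fun ω => M ω x y) →
        ∀ x y, Measurable fun ω => l.foldl (fun σ t => T ω t σ) (M ω) x y := by
    intro T hT l
    induction l with
    | nil => exact fun M hM => hM
    | cons t l ih => exact fun M hM => ih _ (hT t M hM)
  have hfirst := fold (fun ω t σ => noiseLayer p (A.unitary ω t * σ * (A.unitary ω t)ᴴ))
    (fun t M hM => hnoise _ (hmul _ _ (hmul _ _ (hU t) hM) (hU' t))) (List.finRange m)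
    (fun _ => ρ) fun x y => measurable_const
  exact fold (fun ω t σ => noiseLayer p ((A.unitary ω t)ᴴ * σ * A.unitary ω t))
    (fun t M hM => hnoise _ (hmul _ _ (hmul _ _ (hU' t) hM) (hU t))) (List.finRange m).reverse
    _ hfirst x y

theorem measurable_edgeOutput (A : LocalArchitecture k L m) (p : ℝ) (ρ : Op (Site k L))
    (e : Sym2 (Site k L)) : Measurable (A.edgeOutput p ρ e) :=
  Finset.measurable_sum _ fun x _ =>
    (Complex.measurable_re.comp (A.measurable_channel_apply p ρ x x)).const_mul _

theorem trace_cutOp_mul_re (G : SimpleGraph (Site k L)) [DecidableRel G.Adj]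
    (σ : Op (Site k L)) :
    (cutOp G * σ).trace.re = ∑ e ∈ G.edgeFinset, ∑ x, edgeValue e x * (σ x x).re := by
  rw [Finset.sum_comm]
  simp only [cutOp, Matrix.trace, Matrix.diag_apply, Matrix.diagonal_mul, Complex.re_sum,
    Complex.re_ofReal_mul, cutValue, Finset.sum_mul]
  rfl

theorem cutOutput_eq_sum (A : LocalArchitecture k L m) (G : SimpleGraph (Site k L))
    [DecidableRel G.Adj] (p : ℝ) (ρ : Op (Site k L)) (ω : A.Instance) :
    A.cutOutput G p ρ ω = ∑ e ∈ G.edgeFinset, A.edgeOutput p ρ e ω :=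
  trace_cutOp_mul_re G _

instance (A : LocalArchitecture k L m) : IsProbabilityMeasure A.law := by
  unfold law
  infer_instance

theorem avgCutOutput_eq_sum (A : LocalArchitecture k L m) (G : SimpleGraph (Site k L))
    [DecidableRel G.Adj] {p : ℝ} (hp : p ∈ Set.Icc (0 : ℝ) 1) {ρ : Op (Site k L)}
    (hρ : IsState ρ) :
    A.avgCutOutput G p ρ = ∑ e ∈ G.edgeFinset, ∫ ω, A.edgeOutput p ρ e ω ∂A.law := by
  have hint : ∀ x, Integrable (fun ω => A.channel p ω ρ x x) A.law := by
    intro x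
    refine Integrable.of_bound (A.measurable_channel_apply p ρ x x).aestronglyMeasurable 1
      (Filter.Eventually.of_forall fun ω => ?_)
    have hst := A.isState_channel hp ω hρ
    have h0 : 0 ≤ A.channel p ω ρ x x := hst.1.diag_nonneg
    have h1 := (hst.sum_mul_diag_mem_Icc (f := fun y => if y = x then 1 else 0)
      fun y => by split_ifs <;> simp).2
    simp only [ite_mul, one_mul, zero_mul, Finset.sum_ite_eq', Finset.mem_univ, if_true] at h1
    have h2 := congrArg Complex.re (Complex.norm_of_nonneg' h0)
    rw [Complex.ofReal_re] at h2
    exact h2.le.trans h1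
  have hre : ∀ x, Integrable (fun ω => (A.channel p ω ρ x x).re) A.law := fun x => (hint x).re
  rw [avgCutOutput, trace_cutOp_mul_re]
  refine Finset.sum_congr rfl fun e _ => ?_
  unfold edgeOutput
  rw [integral_finsetSum _ fun x _ => (hre x).const_mul _]
  refine Finset.sum_congr rfl fun x _ => ?_
  rw [integral_const_mul, avgChannel]
  congr 1
  exact (integral_re (hint x)).symm

/-! ### Counting edges whose light cones meet -/

omit [∀ i, NeZero (L i)] in
theorem exists_mem_ball_of_not_disjoint_lightCone (A : LocalArchitecture k L m)
    {e e' : Sym2 (Site k L)} (h : ¬ Disjoint (A.lightCone e) (A.lightCone e')) :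
    ∃ v ∈ e, ∃ v' ∈ e', v' ∈ ball (2 * A.depth + 1) v := by
  classical
  obtain ⟨q, hq, hq'⟩ := Finset.not_disjoint_iff.mp h
  rw [lightCone, Finset.mem_filter] at hq hq'
  obtain ⟨h12, h21⟩ := (A.neighbor q.1 q.2.1 q.2.2).mem_ball_one
  -- The shared gate may meet the two balls in different qubits, which are neighbours.
  have key : ∀ a b : Site k L, a ∈ edgeBall e A.depth → b ∈ edgeBall e' A.depth → b ∈ ball 1 a →
      ∃ v ∈ e, ∃ v' ∈ e', v' ∈ ball (2 * A.depth + 1) v := by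
    rintro a b ⟨v, hv, ha⟩ ⟨v', hv', hb⟩ hab
    refine ⟨v, hv, v', hv', ?_⟩
    have h := mem_ball_add (mem_ball_add ha hab) (mem_ball_comm hb)
    rwa [show A.depth + 1 + A.depth = 2 * A.depth + 1 by ring] at h
  rcases hq.2 with h1 | h1 <;> rcases hq'.2 with h2 | h2
  · exact key _ _ h1 h2 (mem_ball_self 1 _)
  · exact key _ _ h1 h2 h12
  · exact key _ _ h1 h2 h21
  · exact key _ _ h1 h2 (mem_ball_self 1 _)

theorem ncard_conflict_lt (A : LocalArchitecture k L m) (G : SimpleGraph (Site k L))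
    [DecidableRel G.Adj] {Δ : ℕ} (hdeg : ∀ v, G.degree v ≤ Δ) {e : Sym2 (Site k L)}
    (he : e ∈ G.edgeFinset) :
    {b ∈ (G.edgeFinset : Set (Sym2 (Site k L))) |
      b ≠ e ∧ ¬ Disjoint (A.lightCone e) (A.lightCone b)}.ncard <
      2 * (4 * A.depth + 3) ^ k * Δ := by
  classical
  set R := 2 * A.depth + 1 with hR
  induction e using Sym2.ind with
  | _ i j =>
    set T : Finset (Sym2 (Site k L)) :=
      (ball R i ∪ ball R j).biUnion fun w => G.incidenceFinset w with hT
    have hTcard : T.card ≤ 2 * (4 * A.depth + 3) ^ k * Δ := by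
      refine (Finset.card_biUnion_le_card_mul _ _ Δ fun w _ => ?_).trans ?_
      · rw [SimpleGraph.card_incidenceFinset_eq_degree]
        exact hdeg w
      · refine Nat.mul_le_mul_right Δ ((Finset.card_union_le _ _).trans ?_)
        have hi := card_ball_le R i
        have hj := card_ball_le R j
        rw [show 2 * R + 1 = 4 * A.depth + 3 by omega] at hi hj
        omega
    have heT : s(i, j) ∈ T := by
      refine Finset.mem_biUnion.mpr ⟨i, Finset.mem_union_left _ (mem_ball_self R i), ?_⟩
      rw [SimpleGraph.mem_incidenceFinset]
      exact ⟨SimpleGraph.mem_edgeFinset.mp he, Sym2.mem_mk_left i j⟩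
    refine lt_of_le_of_lt (b := (T.erase s(i, j)).card) ?_
      (lt_of_lt_of_le (Finset.card_erase_lt_of_mem heT) hTcard)
    rw [← Set.ncard_coe_finset]
    refine Set.ncard_le_ncard ?_ (Finset.finite_toSet _)
    rintro b ⟨hb, hbe, hbd⟩
    obtain ⟨v, hv, v', hv', hvv'⟩ := A.exists_mem_ball_of_not_disjoint_lightCone hbd
    refine Finset.mem_coe.mpr (Finset.mem_erase.mpr ⟨hbe, Finset.mem_biUnion.mpr ⟨v', ?_, ?_⟩⟩)
    · rcases Sym2.mem_iff.mp hv with rfl | rfl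
      · exact Finset.mem_union_left _ hvv'
      · exact Finset.mem_union_right _ hvv'
    · rw [SimpleGraph.mem_incidenceFinset]
      exact ⟨SimpleGraph.mem_edgeFinset.mp (Finset.mem_coe.mp hb), hv'⟩

end LocalArchitecture

end NoisyCircuit

end

theorem proposition2 (k : ℕ) (hk : 1 ≤ k) :
    ∃ c : ℝ, 0 < c ∧
      ∀ (L : Fin k → ℕ) [∀ i, NeZero (L i)] (m : ℕ) (_hm : 1 ≤ m)
        (A : NoisyCircuit.LocalArchitecture k L m)
        (G : SimpleGraph (NoisyCircuit.Site k L)) [DecidableRel G.Adj]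
        (Δ : ℕ) (_hΔ : 1 ≤ Δ) (_hdeg : ∀ v, G.degree v ≤ Δ)
        (p : ℝ) (_hp : p ∈ Set.Icc (0 : ℝ) 1)
        (ρ : NoisyCircuit.Op (NoisyCircuit.Site k L)) (_hρ : NoisyCircuit.IsState ρ)
        (α : ℝ) (_hα : 0 < α),
        A.law.real {ω | α * (G.edgeFinset.card : ℝ) ≤
            |A.cutOutput G p ρ ω - A.avgCutOutput G p ρ|} ≤
          2 * Real.exp (-(c * (α ^ 2 * (G.edgeFinset.card : ℝ) /
            ((Δ : ℝ) ^ 2 * (A.depth : ℝ) ^ (2 * k))))) := by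
  -- Each edge is in conflict with fewer than `K = 2 (4 D + 3) ^ k Δ ≤ 2 (7 D) ^ k Δ` others, and
  -- `2 / K ^ 2` is at least `1 / (2 * 49 ^ k)` times `1 / (Δ ^ 2 * D ^ (2 * k))`.
  refine ⟨1 / (2 * 49 ^ k), by positivity, ?_⟩
  intro L _ m hm A G _ Δ hΔ hdeg p hp ρ hρ α hα
  have hmain := NoisyCircuit.measure_abs_sum_sub_ge_le NoisyCircuit.gateHaar
    (A.edgeOutput p ρ) A.lightCone (A.measurable_edgeOutput p ρ)
    (fun e ω => A.edgeOutput_mem_Icc hp hρ e ω) (A.edgeOutput_dependsOn p ρ) G.edgeFinset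
    (2 * (4 * A.depth + 3) ^ k * Δ) (fun e he => A.ncard_conflict_lt G hdeg he)
    (ε := α * G.edgeFinset.card) (by positivity)
  simp_rw [A.cutOutput_eq_sum, A.avgCutOutput_eq_sum G hp hρ]
  refine hmain.trans ?_
  gcongr 2 * Real.exp (-?_)
  set D := A.depth with hD
  have hD1 : 1 ≤ D := by rw [hD, NoisyCircuit.LocalArchitecture.depth]; omega
  set N : ℝ := (G.edgeFinset.card : ℝ) with hN
  -- Without edges both exponents are zero, one of them as a quotient by zero.
  rcases Nat.eq_zero_or_pos G.edgeFinset.card with h0 | h0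
  · have : N = 0 := by rw [hN, h0, Nat.cast_zero]
    simp [this]
  have hNpos : 0 < N := by rw [hN]; exact_mod_cast h0
  have hΔpos : (0 : ℝ) < Δ := by exact_mod_cast hΔ
  have hDpos : (0 : ℝ) < D := by exact_mod_cast hD1
  have hK : (((2 * (4 * D + 3) ^ k * Δ : ℕ) : ℝ)) ^ 2 ≤
      4 * 49 ^ k * ((Δ : ℝ) ^ 2 * (D : ℝ) ^ (2 * k)) := by
    have h7 : (4 * (D : ℝ) + 3) ≤ 7 * D := by
      have : (1 : ℝ) ≤ D := by exact_mod_cast hD1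
      linarith
    push_cast
    calc (2 * (4 * (D : ℝ) + 3) ^ k * Δ) ^ 2 ≤ (2 * (7 * (D : ℝ)) ^ k * Δ) ^ 2 := by gcongr
      _ = 4 * (7 ^ 2) ^ k * ((Δ : ℝ) ^ 2 * (D : ℝ) ^ (2 * k)) := by
        rw [← pow_mul, mul_pow]
        ring
      _ = _ := by norm_num
  have hKpos : (0 : ℝ) < ((2 * (4 * D + 3) ^ k * Δ : ℕ) : ℝ) ^ 2 := by
    have : 0 < 2 * (4 * D + 3) ^ k * Δ := by positivity
    positivity
  calc 1 / (2 * 49 ^ k) * (α ^ 2 * N / ((Δ : ℝ) ^ 2 * (D : ℝ) ^ (2 * k)))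
      = 2 * (α * N) ^ 2 / (4 * 49 ^ k * ((Δ : ℝ) ^ 2 * (D : ℝ) ^ (2 * k)) * N) := by
        field_simp
        ring
    _ ≤ 2 * (α * N) ^ 2 / (((2 * (4 * D + 3) ^ k * Δ : ℕ) : ℝ) ^ 2 * N) := by gcongr
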